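/- Let $A$ be a set of (infinite) regular cardinals and let $I$ be an ideal on $A$ (a family of subsets of $A$ containing $\emptyset$ and closed under subsets and finite unions). For functions $f,g$ from $A$ to the ordinals write $f\le_I g$ if $\{a\in A: f(a)\not\le g(a)\}\in I$ and $f<_I g$ if $\{a\in A: f(a)\not< g(a)\}\in I$, and let $\prod A$ be the set of functions $f$ on $A$ with $f(a)<a$ for all $a\in A$. For an infinite regular cardinal $\theta$, say that $I$ is $\theta$-regular if for every sequence $\langle B_i : i<\theta\rangle$ of subsets of $A$ not belonging to $I$ there is $H\subseteq\theta$ with $|H|=\theta$ and $\bigcap_{i\in H}B_i\ne\emptyset$; let $\mathrm{reg}(I)$ be the least regular $\theta$ such that $I$ is $\theta$-regular. Let $\lambda>\mathrm{reg}(I)$ be a regular cardinal such that $\prod A/I$ is $\lambda$-directed, i.e. every $F\subseteq\prod A$ with $|F|<\lambda$ has a $\le_I$-upper bound in $\prod A$. Let $\vec f=\langle f_\xi : \xi<\lambda\rangle$ be a sequence of functions in $\prod A$ that is $<_I$-increasing, i.e. $f_\eta<_I f_\xi$ whenever $\eta<\xi<\lambda$. Then there is a sequence $\vec g=\langle g_\xi:\xi<\lambda\rangle$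 of functions in $\prod A$ such that: 1. $\vec g$ is $<_I$-increasing; 2. for each $\xi<\lambda$, $f_\xi(a)<g_{\xi+1}(a)$ for every $a\in A$; 3. for every regular cardinal $\theta$ such that $\theta^{++}<\lambda$, $\{a\in A : a\le\theta^{++}\}\in I$, and $I$ is $\theta$-regular, the sequence $\vec g$ is $\mathrm{Good}_\theta$: there is a function $g$ from $A$ to the ordinals with $\{a\in A:\mathrm{cf}(g(a))<\theta\}\in I$ that is an $I$-exact upper bound of $\vec g$, i.e. (a) $g_\xi\le_I g$ for all $\xi<\lambda$, (b) $g\le_I g'$ for every function $g'$ from $A$ to the ordinals such that $g_\xi\le_I g'$ for all $\xi<\lambda$, and (c) for every function $h$ from $A$ to the ordinals with $h<_I g$ there is $\xi<\lambda$ with $h<_I g_\xi$. -/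

import Mathlib

universe u v

namespace PCF

/-- `f R_I g` : the set of indices at which `R (f a) (g a)` fails belongs to the ideal `I`.
An ideal on a set `α` is an ideal of the power set of `α` (improper ideals are allowed). -/
def RelMod {α : Type v} (I : Order.Ideal (Set α)) (R : Ordinal.{u} → Ordinal.{u} → Prop)
    (f g : α → Ordinal.{u}) : Prop :=
  {a : α | ¬ R (f a) (g a)} ∈ I

/-- `f ≤_I g`. -/
def LEMod {α : Type v} (I : Order.Ideal (Set α)) (f g : α → Ordinal.{u}) : Prop :=
  RelMod I (· ≤ ·) f g

/-- `f <_I g`. -/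
def LTMod {α : Type v} (I : Order.Ideal (Set α)) (f g : α → Ordinal.{u}) : Prop :=
  RelMod I (· < ·) f g

/-- The sequence `⟨f ξ : ξ < lam⟩` is `<_I`-increasing. Sequences of length `lam` are functions on
the ordinals of which only the values below the initial ordinal of `lam` are considered. -/
def IncreasingMod {α : Type v} (I : Order.Ideal (Set α)) (lam : Cardinal.{u})
    (f : Ordinal.{u} → α → Ordinal.{u}) : Prop :=
  ∀ η ξ : Ordinal.{u}, η < ξ → ξ < lam.ord → LTMod I (f η) (f ξ)

/-- `h` is an `I`-upper bound for the family `F`. -/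
def IsUpperBoundMod {α : Type v} (I : Order.Ideal (Set α)) (F : Set (α → Ordinal.{u}))
    (h : α → Ordinal.{u}) : Prop :=
  ∀ g ∈ F, LEMod I g h

/-- `h` is an `I`-least upper bound for the family `F`. -/
def IsLeastUpperBoundMod {α : Type v} (I : Order.Ideal (Set α)) (F : Set (α → Ordinal.{u}))
    (h : α → Ordinal.{u}) : Prop :=
  IsUpperBoundMod I F h ∧ ∀ h' : α → Ordinal.{u}, IsUpperBoundMod I F h' → LEMod I h h'

/-- `h` is an `I`-exact upper bound for the family `F`: a least upper bound such that `F` is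
`<_I`-cofinal in `{g : g <_I h}`. -/
def IsExactUpperBoundMod {α : Type v} (I : Order.Ideal (Set α)) (F : Set (α → Ordinal.{u}))
    (h : α → Ordinal.{u}) : Prop :=
  IsLeastUpperBoundMod I F h ∧
    ∀ g : α → Ordinal.{u}, LTMod I g h → ∃ k ∈ F, LTMod I g k

/-- `Good_θ` for the sequence `⟨f ξ : ξ < lam⟩`: it has an exact upper bound `h` such that
`{a : cf (h a) < θ} ∈ I`. -/
def Good {α : Type v} (I : Order.Ideal (Set α)) (lam θ : Cardinal.{u})
    (f : Ordinal.{u} → α → Ordinal.{u}) : Prop :=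
  ∃ h : α → Ordinal.{u}, IsExactUpperBoundMod I (f '' Set.Iio lam.ord) h ∧
    {a : α | (h a).cof < θ} ∈ I

/-- `I` is `θ`-regular: among any `θ` many `I`-positive sets there are `θ` many with a common
element. -/
def IsRegularIdeal {α : Type v} (I : Order.Ideal (Set α)) (θ : Cardinal.{u}) : Prop :=
  ∀ (ι : Type u), Cardinal.mk ι = θ → ∀ B : ι → Set α, (∀ i, B i ∉ I) →
    ∃ H : Set ι, Cardinal.mk H = θ ∧ (⋂ i ∈ H, B i).Nonempty

/-- `reg(I)`: the least regular cardinal `θ` such that `I` is `θ`-regular. -/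
noncomputable def reg {α : Type v} (I : Order.Ideal (Set α)) : Cardinal.{u} :=
  sInf {θ : Cardinal.{u} | θ.IsRegular ∧ IsRegularIdeal I θ}

/-- The minimum defining `reg(I)` is attained. -/
theorem reg_mem {α : Type v} [Small.{u} α] (I : Order.Ideal (Set α)) :
    (reg.{u} I).IsRegular ∧ IsRegularIdeal I (reg.{u} I) := by
  refine csInf_mem (s := {θ : Cardinal.{u} | θ.IsRegular ∧ IsRegularIdeal I θ}) ?_
  have hinf : Cardinal.aleph0 ≤ max Cardinal.aleph0 (Cardinal.mk (Shrink.{u} α)) :=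
    le_max_left _ _
  have hreg := Cardinal.isRegular_succ hinf
  refine ⟨_, hreg, ?_⟩
  intro ι hι B hB
  have hne : ∀ i, (B i).Nonempty := by
    intro i
    rw [Set.nonempty_iff_ne_empty]
    intro h
    exact hB i (h ▸ I.bot_mem)
  choose c hc using hne
  obtain ⟨a, ha⟩ := Cardinal.infinite_pigeonhole_card (fun i => equivShrink α (c i))
    (Order.succ (max Cardinal.aleph0 (Cardinal.mk (Shrink.{u} α)))) hι.ge
    hreg.aleph0_le (by
      rw [hreg.cof_ord]
      exact Order.lt_succ_of_le (le_max_right _ _))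
  refine ⟨_, le_antisymm ((Cardinal.mk_set_le _).trans hι.le) ha, (equivShrink α).symm a, ?_⟩
  simp only [Set.mem_iInter]
  intro i hi
  have hi' : equivShrink α (c i) = a := hi
  rw [← hi', Equiv.symm_apply_apply]
  exact hc i

/-- The product `∏ A` of a set of cardinals: functions `f` on `A` with `f a < a`, where `a` is
identified with its initial ordinal. -/
def prodSet (A : Set Cardinal.{u}) : Set (A → Ordinal.{u}) :=
  {f | ∀ a : A, f a < (a : Cardinal.{u}).ord}

/-- `∏ A / I` is `lam`-directed: every subset of `∏ A` of cardinality less than `lam` has a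
`≤_I`-upper bound in `∏ A`. -/
def ProdDirected (A : Set Cardinal.{u}) (I : Order.Ideal (Set A)) (lam : Cardinal.{u}) : Prop :=
  ∀ F : Set (A → Ordinal.{u}), F ⊆ prodSet A → Cardinal.mk F < Cardinal.lift.{u + 1} lam →
    ∃ h ∈ prodSet A, IsUpperBoundMod I F h

end PCF

/-!
The statement is a pcf-theoretic "existence of exact upper bounds" result. Its proof has three parts.

*Construction* (`exists_obedient`). By recursion, `g ξ` is taken above a `≤_I`-bound of the previous
values, above `f η` if `ξ = η + 1`, and, at each `a > cf ξ`, above the values of `g` along a club of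
`ξ` of size at most `cf ξ`; the latter supremum stays below `a` because `a` is regular. If
`a > μ` holds off a set of `I`, then `g` is obedient at cofinality `μ`: off one set of `I`, the value
at a `δ` of cofinality `μ` bounds all the values along a club of `δ`.

*Bounding projections* (`Obedient.exists_isUpperBoundMod_proj`). Let `μ = θ⁺⁺` and let `S a` be sets
of fewer than `θ` ordinals that bound `g`. Then some projection `proj S (g ξ)` is an upper bound of
`g`. Otherwise, a continuous sequence `x` of length `μ` is built such that each `proj S (g (x β))`
fails to bound the next terms, and such that `x` passes the first bound of each initial part
`{g (x k) : k ∈ C δ, k ≤ β}` of each member of a club guessing sequence `C`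
(`exists_club_guessing`, Shelah's theorem for cofinality `θ` below `θ⁺⁺`). Obedience at `sup x`
provides a club of `μ`; a set `C d` guessed inside it consists of `θ` many places where such bounds
exist. Along it the sequence is strongly increasing, and the `θ`-regularity of `I` yields one `a` at
which `θ` many projections increase strictly inside `S a`, which is too small for that.

*Exact upper bounds* (`Obedient.exists_isLeastUpperBoundMod`, `Obedient.good`). Without a least upper
bound, adding values of smaller and smaller upper bounds to the sets `S a` would give, again by
`θ`-regularity, an infinite descending sequence of ordinals. Projecting to two values shows that a
least upper bound is exact, and projecting to short cofinal subsets of its values shows that these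
have cofinality at least `θ`.
-/

namespace PCF

open Set Cardinal Filter

/-! ### Suprema of ordinals below a regular cardinal -/

/-- `supBelow f i` is the supremum of the values `f j`, `j < i`. -/
noncomputable def supBelow (f : Ordinal.{u} → Ordinal.{u}) (i : Ordinal.{u}) : Ordinal.{u} :=
  sSup (f '' Iio i)

theorem le_supBelow (f : Ordinal.{u} → Ordinal.{u}) {i j : Ordinal.{u}} (h : j < i) :
    f j ≤ supBelow f i :=
  le_csSup Ordinal.bddAbove_of_small (mem_image_of_mem f h)

theorem lt_supBelow_iff {f : Ordinal.{u} → Ordinal.{u}} {i x : Ordinal.{u}} :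
    x < supBelow f i ↔ ∃ j < i, x < f j := by
  rw [supBelow, lt_csSup_iff' Ordinal.bddAbove_of_small]
  simp

theorem supBelow_le {f : Ordinal.{u} → Ordinal.{u}} {i x : Ordinal.{u}} (h : ∀ j < i, f j ≤ x) :
    supBelow f i ≤ x := by
  refine csSup_le' ?_
  rintro _ ⟨j, hj, rfl⟩
  exact h j hj

theorem sSup_lt_ord_of_isRegular {κ : Cardinal.{u}} (hκ : κ.IsRegular) {s : Set Ordinal.{u}}
    (hs : #s < lift.{u + 1} κ) (h : ∀ i ∈ s, i < κ.ord) : sSup s < κ.ord := by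
  refine Ordinal.sSup_lt_of_lt_cof ?_ h
  rwa [← Ordinal.lift_cof, hκ.cof_ord]

theorem mk_Iio_lt {κ : Cardinal.{u}} {i : Ordinal.{u}} (hi : i < κ.ord) :
    #(Iio i) < lift.{u + 1} κ := by
  rw [mk_Iio_ordinal, lift_lt]
  exact lt_ord.1 hi

theorem supBelow_lt_ord {κ : Cardinal.{u}} (hκ : κ.IsRegular) {f : Ordinal.{u} → Ordinal.{u}}
    {i : Ordinal.{u}} (hi : i < κ.ord) (h : ∀ j < i, f j < κ.ord) : supBelow f i < κ.ord := by
  refine sSup_lt_ord_of_isRegular hκ (mk_image_le.trans_lt (mk_Iio_lt hi)) ?_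
  rintro _ ⟨j, hj, rfl⟩
  exact h j hj

theorem add_one_lt_ord {κ : Cardinal.{u}} (hκ : κ.IsRegular) {i : Ordinal.{u}} (hi : i < κ.ord) :
    i + 1 < κ.ord :=
  (isSuccLimit_ord hκ.aleph0_le).succ_lt hi

/-- Definition by recursion on the ordinals: the value at `i` may depend on all values below `i`. -/
theorem exists_rec {X : Type v} [Inhabited X] (Φ : Ordinal.{u} → (Ordinal.{u} → X) → X) :
    ∃ f : Ordinal.{u} → X, ∀ i, f i = Φ i (fun j => if j < i then f j else default) := by
  classical
  refine ⟨WellFounded.fix (r := (· < ·)) Ordinal.lt_wf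
    (fun i prev => Φ i (fun j => if h : j < i then prev j h else default)), fun i => ?_⟩
  rw [WellFounded.fix_eq]
  simp only [dite_eq_ite]

theorem exists_cofinal_subset (o : Ordinal.{u}) :
    ∃ K : Set Ordinal.{u}, K ⊆ Iio o ∧ (∀ x < o, ∃ c ∈ K, x ≤ c) ∧ #K = lift.{u + 1} o.cof := by
  obtain ⟨s, hs, hcard⟩ := Order.exists_cof_eq (Iio o)
  refine ⟨Subtype.val '' s, ?_, ?_, ?_⟩
  · rintro _ ⟨x, -, rfl⟩
    exact x.2
  · intro x hx
    obtain ⟨c, hc, hxc⟩ := hs ⟨x, hx⟩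
    exact ⟨c, mem_image_of_mem _ hc, hxc⟩
  · rw [mk_image_eq Subtype.val_injective, hcard, Ordinal.cof_Iio, Ordinal.lift_cof]

theorem lift_cof_le_mk {o : Ordinal.{u}} {K : Set Ordinal.{u}} (hK : K ⊆ Iio o)
    (h : ∀ x < o, ∃ c ∈ K, x ≤ c) : lift.{u + 1} o.cof ≤ #K := by
  have hcof : IsCofinal (Subtype.val ⁻¹' K : Set (Iio o)) := by
    intro x
    obtain ⟨c, hc, hxc⟩ := h x x.2
    exact ⟨⟨c, hK hc⟩, hc, hxc⟩
  have h1 := Order.cof_le hcof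
  rw [Ordinal.cof_Iio, ← Ordinal.lift_cof] at h1
  exact h1.trans (mk_preimage_of_injective _ _ Subtype.val_injective)

/-! ### Closure points and club guessing -/

/-- The ordinals closed under `F`; `0` is always among them. The sets of closure points of functions
`μ.ord → μ.ord` serve as a base of the club filter of a regular uncountable cardinal `μ`. -/
def closedPts (F : Ordinal.{u} → Ordinal.{u}) : Set Ordinal.{u} :=
  {x | ∀ y < x, F y < x}

theorem sSup_mem_closedPts {F : Ordinal.{u} → Ordinal.{u}} {t : Set Ordinal.{u}}
    (ht : t ⊆ closedPts F) (hb : BddAbove t) : sSup t ∈ closedPts F := by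
  intro y hy
  obtain ⟨z, hz, hyz⟩ := exists_lt_of_lt_csSup' hy
  exact (ht hz y hyz).trans_le (le_csSup hb hz)

theorem closedPts_anti {F G : Ordinal.{u} → Ordinal.{u}} (h : ∀ x, F x ≤ G x) :
    closedPts G ⊆ closedPts F :=
  fun _ hx y hy => (h y).trans_lt (hx y hy)

theorem exists_mem_closedPts_gt {μ : Cardinal.{u}} (hμ : μ.IsRegular) (hω : ℵ₀ < μ)
    {F : Ordinal.{u} → Ordinal.{u}} (hF : ∀ x < μ.ord, F x < μ.ord) {x : Ordinal.{u}}
    (hx : x < μ.ord) : ∃ y ∈ closedPts F, x < y ∧ y < μ.ord := by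
  -- The closure point is the limit of the iterates of `G`, where `G z` exceeds all `F y`, `y < z`.
  let G : Ordinal.{u} → Ordinal.{u} := fun z => max (z + 1) (supBelow (fun y => F y + 1) z)
  have hG : ∀ z < μ.ord, G z < μ.ord := fun z hz =>
    max_lt (add_one_lt_ord hμ hz)
      (supBelow_lt_ord hμ hz fun j hj => add_one_lt_ord hμ (hF j (hj.trans hz)))
  have hit : ∀ n, G (G^[n] x) ≤ Ordinal.nfp G x := by
    intro n
    rw [← Function.iterate_succ_apply' G n x]
    exact Ordinal.iterate_le_nfp G x (n + 1)
  refine ⟨Ordinal.nfp G x, ?_, ?_, Ordinal.nfp_lt_ord (by rwa [hμ.cof_ord]) hG hx⟩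
  · intro y hy
    obtain ⟨n, hn⟩ := Ordinal.lt_nfp_iff.1 hy
    refine lt_of_lt_of_le ?_ (hit n)
    exact (Order.lt_add_one_iff.2 le_rfl).trans_le
      ((le_supBelow (fun y => F y + 1) hn).trans (le_max_right _ _))
  · exact ((Order.lt_add_one_iff.2 le_rfl).trans_le (le_max_left (x + 1) _)).trans_le (hit 0)

theorem exists_limit_closedPts {κ μ : Cardinal.{u}} (hκ : κ.IsRegular) (hμ : μ.IsRegular)
    (hκμ : κ < μ) {F : Ordinal.{u} → Ordinal.{u}} (hF : ∀ x < μ.ord, F x < μ.ord) :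
    ∃ δ < μ.ord, δ.cof = κ ∧ ∀ x < δ, ∃ y ∈ closedPts F, x < y ∧ y < δ := by
  classical
  -- Truncating `F` makes every ordinal from `μ.ord` on a closure point, so that the closure points
  -- form an unbounded class with a normal enumeration; `δ` is its value at `κ.ord`.
  let F' : Ordinal.{u} → Ordinal.{u} := fun x => if x < μ.ord then F x else 0
  have hF' : ∀ x, F' x < μ.ord := by
    intro x
    by_cases h : x < μ.ord
    · simpa [F', h] using hF x h
    · simpa [F', h] using hμ.ord_pos
  have hunb : ¬ BddAbove (closedPts F') := by
    rintro ⟨b, hb⟩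
    have h1 : max b μ.ord + 1 ∈ closedPts F' := fun y _ =>
      (hF' y).trans_le ((le_max_right b μ.ord).trans (Order.le_succ _))
    exact absurd ((le_max_left b μ.ord).trans_lt (Order.lt_succ _)) (hb h1).not_gt
  have hnorm : Order.IsNormal (Ordinal.enumOrd (closedPts F')) :=
    Ordinal.isNormal_enumOrd (fun t ht _ hb => sSup_mem_closedPts ht hb) hunb
  have hlt : ∀ i, i < μ.ord → Ordinal.enumOrd (closedPts F') i < μ.ord := by
    intro i
    induction i using WellFoundedLT.induction with
    | ind i ih =>
      intro hi
      obtain ⟨y, hy, hxy, hyμ⟩ := exists_mem_closedPts_gt hμ (hκ.aleph0_le.trans_lt hκμ)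
        (fun x _ => hF' x) (supBelow_lt_ord hμ hi fun j hj => ih j hj (hj.trans hi))
      exact (Ordinal.enumOrd_le_of_forall_lt hy fun b hb =>
        (le_supBelow _ hb).trans_lt hxy).trans_lt hyμ
  have hκlim := isSuccLimit_ord hκ.aleph0_le
  have hδ := hlt κ.ord (ord_lt_ord.2 hκμ)
  refine ⟨_, hδ, ?_, ?_⟩
  · rw [Ordinal.cof_map_of_isNormal hnorm hκlim, hκ.cof_ord]
  · intro x hx
    obtain ⟨i, hi, hxi⟩ := (hnorm.lt_iff_exists_lt hκlim).1 hx
    refine ⟨_, ?_, hxi, hnorm.strictMono hi⟩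
    intro y hy
    have h1 := Ordinal.enumOrd_mem hunb i y hy
    have h2 : y < μ.ord := hy.trans ((hnorm.strictMono hi).trans hδ)
    simpa [F', h2] using h1

/-- **Shelah's club guessing theorem** for the ordinals of cofinality `κ` below a regular
`μ > κ⁺`, with clubs given as sets of closure points. -/
theorem exists_club_guessing {κ μ : Cardinal.{u}} (hκ : κ.IsRegular) (hμ : μ.IsRegular)
    (hκμ : Order.succ κ < μ) :
    ∃ C : Ordinal.{u} → Set Ordinal.{u}, ∀ F : Ordinal.{u} → Ordinal.{u},
      (∀ x < μ.ord, F x < μ.ord) → ∃ δ < μ.ord, C δ ⊆ Iio δ ∧ (∀ x < δ, ∃ c ∈ C δ, x < c) ∧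
        #(C δ) = lift.{u + 1} κ ∧ C δ ⊆ closedPts F := by
  by_contra! hcon
  choose G hG hbad using hcon
  choose K hK hKcof hKcard using exists_cofinal_subset.{u}
  -- `drop F γ` is the last closure point of `F` up to `γ`. Dropping the points of `K δ` to the
  -- closure points of `F` gives the candidate `C F`, and `G (C F)` is a club it does not guess.
  let drop : (Ordinal.{u} → Ordinal.{u}) → Ordinal.{u} → Ordinal.{u} := fun F γ =>
    sSup (closedPts F ∩ Iic γ)
  let C : (Ordinal.{u} → Ordinal.{u}) → Ordinal.{u} → Set Ordinal.{u} := fun F δ => drop F '' K δ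
  have hbdd : ∀ (F : Ordinal.{u} → Ordinal.{u}) γ, BddAbove (closedPts F ∩ Iic γ) :=
    fun F γ => ⟨γ, fun x hx => hx.2⟩
  have hdrop_mem : ∀ F γ, drop F γ ∈ closedPts F := fun F γ =>
    sSup_mem_closedPts inter_subset_left (hbdd F γ)
  have hdrop_le : ∀ F γ, drop F γ ≤ γ := fun F γ => csSup_le' fun x hx => hx.2
  have hle_drop : ∀ F γ x, x ∈ closedPts F → x ≤ γ → x ≤ drop F γ := fun F γ x hx hxγ =>
    le_csSup (hbdd F γ) ⟨hx, hxγ⟩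
  obtain ⟨E, hE⟩ := exists_rec (X := Ordinal.{u} → Ordinal.{u})
    (fun α prev x => supBelow (fun β => G (C (prev β)) x) α)
  have hE' : ∀ α x, E α x = supBelow (fun β => G (C (E β)) x) α := by
    intro α x
    rw [hE]
    refine congrArg sSup (image_congr fun β hβ => ?_)
    simp only [if_pos (mem_Iio.1 hβ)]
  have hEmono : ∀ α β, α ≤ β → ∀ x, E α x ≤ E β x := by
    intro α β hαβ x
    rw [hE' α, hE' β]
    exact supBelow_le fun j hj => le_supBelow (fun β => G (C (E β)) x) (hj.trans_le hαβ)
  have hκ' : (Order.succ κ).IsRegular := isRegular_succ hκ.aleph0_le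
  set ν := (Order.succ κ).ord
  have hEμ : ∀ x < μ.ord, E ν x < μ.ord := by
    intro x hx
    rw [hE']
    exact supBelow_lt_ord hμ (ord_lt_ord.2 hκμ) fun j _ => hG _ x hx
  obtain ⟨δ, hδ, hδcof, hδlim⟩ := exists_limit_closedPts hκ hμ
    ((Order.lt_succ κ).trans hκμ) hEμ
  have hdrop_anti : ∀ α β, α ≤ β → ∀ γ, drop (E β) γ ≤ drop (E α) γ := fun α β hαβ γ =>
    hle_drop _ _ _ (closedPts_anti (hEmono α β hαβ) (hdrop_mem _ _)) (hdrop_le _ _)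
  -- For fixed `γ` the decreasing sequence `α ↦ drop (E α) γ` is constant from some `s γ < κ⁺` on,
  -- and `κ⁺` is regular, so the `κ` many points of `K δ` stabilize simultaneously.
  have hstab : ∀ γ, ∃ α < ν, ∀ β < ν, α ≤ β → drop (E β) γ = drop (E α) γ := by
    intro γ
    have hne : ((fun α => drop (E α) γ) '' Iio ν).Nonempty := ⟨_, 0, hκ'.ord_pos, rfl⟩
    obtain ⟨α, hα, hαmin⟩ := csInf_mem hne
    refine ⟨α, hα, fun β hβ hαβ => (hdrop_anti α β hαβ γ).antisymm ?_⟩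
    have h1 := csInf_le' (mem_image_of_mem (fun α => drop (E α) γ) (mem_Iio.2 hβ))
    exact hαmin.trans_le h1
  choose s hs hconst using hstab
  have hKδ : #(K δ) < lift.{u + 1} (Order.succ κ) := by
    rw [hKcard, hδcof, lift_lt]
    exact Order.lt_succ κ
  set α := sSup (s '' K δ)
  have hαν : α < ν := by
    refine sSup_lt_ord_of_isRegular hκ' (mk_image_le.trans_lt hKδ) ?_
    rintro _ ⟨γ, -, rfl⟩
    exact hs γ
  have hα1ν : α + 1 < ν := add_one_lt_ord hκ' hαν
  have hsα : ∀ γ ∈ K δ, s γ ≤ α := by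
    intro γ hγ
    have : Small.{u} (K δ) := small_subset (hK δ)
    exact le_csSup Ordinal.bddAbove_of_small (mem_image_of_mem s hγ)
  have hCsub : C (E α) δ ⊆ Iio δ := by
    rintro _ ⟨γ, hγ, rfl⟩
    exact (hdrop_le _ _).trans_lt (hK δ hγ)
  have hCcof : ∀ x < δ, ∃ c ∈ C (E α) δ, x < c := by
    intro x hx
    obtain ⟨y, hy, hxy, hyδ⟩ := hδlim x hx
    obtain ⟨γ, hγ, hyγ⟩ := hKcof δ y hyδ
    exact ⟨_, mem_image_of_mem _ hγ, hxy.trans_le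
      (hle_drop _ _ _ (closedPts_anti (hEmono α ν hαν.le) hy) hyγ)⟩
  have hCcard : #(C (E α) δ) = lift.{u + 1} κ := by
    refine le_antisymm (mk_image_le.trans ?_) ?_
    · rw [hKcard, hδcof]
    · rw [← hδcof]
      exact lift_cof_le_mk hCsub fun x hx => (hCcof x hx).imp fun c hc => ⟨hc.1, hc.2.le⟩
  refine hbad (C (E α)) δ hδ hCsub hCcof hCcard ?_
  rintro _ ⟨γ, hγ, rfl⟩
  have h1 : drop (E (α + 1)) γ = drop (E α) γ := by
    rw [hconst γ _ hα1ν ((hsα γ hγ).trans (Order.le_succ α)), hconst γ _ hαν (hsα γ hγ)]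
  rw [← h1]
  refine closedPts_anti (fun x => ?_) (hdrop_mem _ _)
  rw [hE' (α + 1)]
  exact le_supBelow (fun β => G (C (E β)) x) (Order.lt_succ α)

/-! ### Ideals as filters -/

/-- The filter of complements of members of `I`, so that `RelMod I` becomes `∀ᶠ` and
`I`-positivity becomes `∃ᶠ`. -/
def dualFilter {α : Type v} (I : Order.Ideal (Set α)) : Filter α where
  sets := {s | sᶜ ∈ I}
  univ_sets := by
    simpa using I.bot_mem
  sets_of_superset := fun hs hst => I.lower (compl_subset_compl.2 hst) hs
  inter_sets := fun {s t} hs ht => by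
    have h : (s ∩ t)ᶜ = sᶜ ⊔ tᶜ := compl_inter s t
    change (s ∩ t)ᶜ ∈ I
    rw [h]
    exact Order.Ideal.sup_mem hs ht

theorem eventually_dualFilter {α : Type v} {I : Order.Ideal (Set α)} {p : α → Prop} :
    (∀ᶠ a in dualFilter I, p a) ↔ {a | ¬ p a} ∈ I :=
  Iff.rfl

theorem relMod_iff {α : Type v} {I : Order.Ideal (Set α)} {R : Ordinal.{u} → Ordinal.{u} → Prop}
    {f g : α → Ordinal.{u}} : RelMod I R f g ↔ ∀ᶠ a in dualFilter I, R (f a) (g a) :=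
  Iff.rfl

theorem notMem_iff_frequently {α : Type v} {I : Order.Ideal (Set α)} {B : Set α} :
    B ∉ I ↔ ∃ᶠ a in dualFilter I, a ∈ B := by
  rw [Filter.Frequently, eventually_dualFilter]
  simp

theorem IncreasingMod.eventually_le {α : Type v} {I : Order.Ideal (Set α)} {lam : Cardinal.{u}}
    {g : Ordinal.{u} → α → Ordinal.{u}} (hg : IncreasingMod I lam g) {η ξ : Ordinal.{u}}
    (h : η ≤ ξ) (hξ : ξ < lam.ord) : ∀ᶠ a in dualFilter I, g η a ≤ g ξ a := by
  rcases h.eq_or_lt with rfl | h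
  · exact Eventually.of_forall fun _ => le_rfl
  · exact (relMod_iff.1 (hg η ξ h hξ)).mono fun _ h => h.le

theorem IsRegularIdeal.exists_subset {α : Type v} {I : Order.Ideal (Set α)} {θ : Cardinal.{u}}
    (hI : IsRegularIdeal I θ) {C : Set Ordinal.{u}} (hC : #C = lift.{u + 1} θ)
    {B : Ordinal.{u} → Set α} (hB : ∀ c ∈ C, ∃ᶠ a in dualFilter I, a ∈ B c) :
    ∃ H ⊆ C, #H = lift.{u + 1} θ ∧ ∃ a, ∀ c ∈ H, a ∈ B c := by
  have hequiv : Nonempty (ULift.{u + 1} θ.out ≃ C) := by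
    rw [← Cardinal.eq, mk_uLift, mk_out, hC]
  obtain ⟨e⟩ := hequiv
  let e' : θ.out → Ordinal.{u} := fun i => e ⟨i⟩
  have he' : Function.Injective e' := fun i j h => by
    have := e.injective (Subtype.ext h)
    exact ULift.up_injective this
  obtain ⟨H, hH, a, ha⟩ := hI θ.out (mk_out θ) (fun i => B (e' i))
    (fun i => notMem_iff_frequently.2 (hB _ (e ⟨i⟩).2))
  refine ⟨e' '' H, ?_, ?_, a, ?_⟩
  · rintro _ ⟨i, -, rfl⟩
    exact (e ⟨i⟩).2
  · have h1 := mk_image_eq_lift e' H he'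
    rw [lift_id'.{u, u + 1}, hH] at h1
    exact h1
  · rintro _ ⟨i, hi, rfl⟩
    simp only [mem_iInter] at ha
    exact ha i hi

/-! ### Obedient sequences and the bounding projection property -/

/-- The ordinals that are limits of elements of `K`; `0` is always among them. -/
def limitPts (K : Set Ordinal.{u}) : Set Ordinal.{u} :=
  {x | ∀ y < x, ∃ c ∈ K, y < c ∧ c < x}

/-- The sequence `g` of length `lam` is obedient at cofinality `μ`: at each place `δ` of cofinality
`μ`, the value `g δ` bounds, off one set of `I`, all the values of `g` along a club of `δ`. The club
is given as the set of limit points of a cofinal subset of `δ`. -/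
def Obedient {α : Type v} (I : Order.Ideal (Set α)) (lam μ : Cardinal.{u})
    (g : Ordinal.{u} → α → Ordinal.{u}) : Prop :=
  ∀ δ < lam.ord, δ.cof = μ → ∃ K ⊆ Iio δ, (∀ x < δ, ∃ c ∈ K, x ≤ c) ∧
    ∀ᶠ a in dualFilter I, ∀ ξ ∈ limitPts K, ξ < δ → g ξ a ≤ g δ a

/-- The projection of `f` to the sets `S a`: the least element of `S a` that is at least `f a`. It
is the junk value `0` where there is none. -/
noncomputable def proj {α : Type v} (S : α → Set Ordinal.{u}) (f : α → Ordinal.{u}) (a : α) :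
    Ordinal.{u} :=
  sInf {s | s ∈ S a ∧ f a ≤ s}

theorem proj_mem {α : Type v} {S : α → Set Ordinal.{u}} {f : α → Ordinal.{u}} {a : α}
    (h : ∃ s ∈ S a, f a ≤ s) : proj S f a ∈ S a ∧ f a ≤ proj S f a :=
  csInf_mem h

theorem proj_le {α : Type v} {S : α → Set Ordinal.{u}} {f : α → Ordinal.{u}} {a : α}
    {s : Ordinal.{u}} (hs : s ∈ S a) (h : f a ≤ s) : proj S f a ≤ s :=
  csInf_le' ⟨hs, h⟩

/-- The bounding projection property: if the sequence is bounded by sets `S a` of fewer than `θ`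
ordinals, then the projection of some member of the sequence is an upper bound of it. -/
theorem Obedient.exists_isUpperBoundMod_proj {α : Type v} {I : Order.Ideal (Set α)}
    {θ lam : Cardinal.{u}} (hθ : θ.IsRegular) (hlam : lam.IsRegular)
    (hθlam : Order.succ (Order.succ θ) < lam) (hI : IsRegularIdeal I θ)
    {g : Ordinal.{u} → α → Ordinal.{u}} (hg : IncreasingMod I lam g)
    (hob : Obedient I lam (Order.succ (Order.succ θ)) g) {S : α → Set Ordinal.{u}}
    (hS : ∀ ξ < lam.ord, ∀ a, ∃ s ∈ S a, g ξ a ≤ s) (hcard : ∀ a, #(S a) < lift.{u + 1} θ) :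
    ∃ ξ < lam.ord, IsUpperBoundMod I (g '' Iio lam.ord) (proj S (g ξ)) := by
  by_contra! hcon
  have hnxt : ∀ ξ, ∃ η < lam.ord,
      ξ < lam.ord → ∃ᶠ a in dualFilter I, proj S (g ξ) a < g η a := by
    intro ξ
    by_cases hξ : ξ < lam.ord
    · have h1 := hcon ξ hξ
      simp only [IsUpperBoundMod, not_forall] at h1
      obtain ⟨_, ⟨η, hη, rfl⟩, h2⟩ := h1
      refine ⟨η, hη, fun _ h3 => h2 (relMod_iff.2 ?_)⟩
      exact h3.mono fun a ha => not_lt.1 ha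
    · exact ⟨0, hlam.ord_pos, fun h => absurd h hξ⟩
  choose nxt hnxt_lt hnxt using hnxt
  have hθ' : (Order.succ θ).IsRegular := isRegular_succ hθ.aleph0_le
  set μ := Order.succ (Order.succ θ)
  have hμreg : μ.IsRegular := isRegular_succ hθ'.aleph0_le
  have hμlam : μ.ord < lam.ord := ord_lt_ord.2 hθlam
  obtain ⟨C, hC⟩ := exists_club_guessing hθ hμreg (Order.lt_succ (Order.succ θ))
  -- `Bd δ j x` is the set of places whose value bounds, off one set of `I`, all the `g (x k)` with
  -- `k ≤ j` in the guess `C δ`. The continuous sequence `x` of length `μ` runs past the first such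
  -- place, for all guesses simultaneously.
  let Bd : Ordinal.{u} → Ordinal.{u} → (Ordinal.{u} → Ordinal.{u}) → Set Ordinal.{u} :=
    fun δ j x => {σ | σ < lam.ord ∧
      ∀ᶠ a in dualFilter I, ∀ k ∈ C δ, k ≤ j → g (x k) a ≤ g σ a}
  let Φ : Ordinal.{u} → (Ordinal.{u} → Ordinal.{u}) → Ordinal.{u} := fun j x =>
    max (max (x j + 1) (nxt (x j))) (supBelow (fun δ => sInf (Bd δ j x)) μ.ord)
  have hΦcongr : ∀ j x y, (∀ k ≤ j, x k = y k) → Φ j x = Φ j y := by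
    intro j x y h
    have hBd : ∀ δ, Bd δ j x = Bd δ j y := by
      intro δ
      have h1 : ∀ σ a, (∀ k ∈ C δ, k ≤ j → g (x k) a ≤ g σ a) ↔
          (∀ k ∈ C δ, k ≤ j → g (y k) a ≤ g σ a) := fun σ a =>
        forall₃_congr fun k _ hk => by rw [h k hk]
      simp only [Bd, h1]
    simp only [Φ, hBd, h j le_rfl]
  obtain ⟨x, hx⟩ := exists_rec (X := Ordinal.{u}) (fun i prev => supBelow (fun j => Φ j prev) i)
  have hx : ∀ i, x i = supBelow (fun j => Φ j x) i := by
    intro i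
    rw [hx]
    refine congrArg sSup (image_congr fun j hj => hΦcongr j _ _ fun k hk => ?_)
    exact if_pos (hk.trans_lt hj)
  have hΦle : ∀ j i, j < i → Φ j x ≤ x i := by
    intro j i h
    rw [hx i]
    exact le_supBelow (fun j => Φ j x) h
  have hltΦ : ∀ i y, y < x i → ∃ j < i, y < Φ j x := by
    intro i y h
    rw [hx i] at h
    exact lt_supBelow_iff.1 h
  have hmono : StrictMono x := fun j i h =>
    (Order.lt_add_one_iff.2 le_rfl).trans_le
      (((le_max_left _ _).trans (le_max_left _ _)).trans (hΦle j i h))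
  have hnorm : Order.IsNormal x := by
    refine ⟨hmono, fun {i} hi b hb => ?_⟩
    rw [hx i]
    exact supBelow_le fun j hj => (hΦle j (j + 1) (Order.lt_succ j)).trans
      (hb (mem_image_of_mem x (hi.succ_lt hj)))
  have hxlt : ∀ i, i ≤ μ.ord → x i < lam.ord := by
    intro i
    induction i using WellFoundedLT.induction with
    | ind i ih =>
      intro hi
      rw [hx i]
      refine supBelow_lt_ord hlam (hi.trans_lt hμlam) fun j hj => ?_
      refine max_lt (max_lt (add_one_lt_ord hlam (ih j hj (hj.le.trans hi))) (hnxt_lt _)) ?_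
      refine supBelow_lt_ord hlam hμlam fun δ _ => ?_
      rcases (Bd δ j x).eq_empty_or_nonempty with h | h
      · rw [h, Ordinal.sInf_empty]
        exact hlam.ord_pos
      · exact (csInf_mem h).1
  have hμlim := isSuccLimit_ord hμreg.aleph0_le
  obtain ⟨K, hKsub, hKcof, hKbd⟩ := hob (x μ.ord) (hxlt _ le_rfl) (by
    rw [Ordinal.cof_map_of_isNormal hnorm hμlim, hμreg.cof_ord])
  -- `x` maps the closure points of `F` to limit points of `K`.
  let F : Ordinal.{u} → Ordinal.{u} := fun i => sInf {j | i < j ∧ ∃ c ∈ K, x i ≤ c ∧ c < x j}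
  have hF : ∀ i < μ.ord, F i < μ.ord ∧ i < F i ∧ ∃ c ∈ K, x i ≤ c ∧ c < x (F i) := by
    intro i hi
    obtain ⟨c, hcK, hxc⟩ := hKcof (x i) (hmono hi)
    obtain ⟨j, hj, hcj⟩ := (hnorm.lt_iff_exists_lt hμlim).1 (hKsub hcK)
    have hmem : max j (i + 1) ∈ {j | i < j ∧ ∃ c ∈ K, x i ≤ c ∧ c < x j} :=
      ⟨(Order.lt_succ i).trans_le (le_max_right _ _), c, hcK, hxc,
        hcj.trans_le (hmono.monotone (le_max_left _ _))⟩
    exact ⟨(csInf_le' hmem).trans_lt (max_lt hj (add_one_lt_ord hμreg hi)), csInf_mem ⟨_, hmem⟩⟩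
  obtain ⟨d, hd, hCsub, hCcof, hCcard, hCF⟩ := hC F fun i hi => (hF i hi).1
  have hCμ : ∀ k ∈ C d, k < μ.ord := fun k hk => (mem_Iio.1 (hCsub hk)).trans hd
  have hlimit : ∀ k ∈ C d, x k ∈ limitPts K := by
    intro k hk y hy
    obtain ⟨j, hj, hyj⟩ := hltΦ k y hy
    obtain ⟨-, hjF, -⟩ := hF j (hj.trans (hCμ k hk))
    have hFj : F j < k := hCF hk j hj
    obtain ⟨-, -, c, hcK, hxc, hcx⟩ := hF (F j) (hFj.trans (hCμ k hk))
    exact ⟨c, hcK, hyj.trans_le ((hΦle _ _ hjF).trans hxc),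
      hcx.trans (hmono (hCF hk _ hFj))⟩
  have hbd : ∀ β ∈ C d,
      ∀ᶠ a in dualFilter I, ∀ k ∈ C d, k ≤ β → g (x k) a ≤ g (x (β + 1)) a := by
    intro β hβ
    have hmem : x μ.ord ∈ Bd d β x := ⟨hxlt _ le_rfl, hKbd.mono fun a ha k hk _ =>
      ha _ (hlimit k hk) (hmono (hCμ k hk))⟩
    have hle : sInf (Bd d β x) ≤ x (β + 1) :=
      ((le_supBelow (fun δ => sInf (Bd δ β x)) hd).trans (le_max_right _ _)).trans
        (hΦle β (β + 1) (Order.lt_succ β))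
    have hlt : x (β + 1) < lam.ord := hxlt _ (add_one_lt_ord hμreg (hCμ β hβ)).le
    filter_upwards [(csInf_mem ⟨_, hmem⟩ : sInf (Bd d β x) ∈ Bd d β x).2,
      hg.eventually_le hle hlt] with a ha1 ha2 k hk hkβ
    exact (ha1 k hk hkβ).trans ha2
  let next : Ordinal.{u} → Ordinal.{u} := fun β => sInf {c | c ∈ C d ∧ β < c}
  have hnext : ∀ β ∈ C d, next β ∈ C d ∧ β < next β := fun β hβ =>
    csInf_mem (s := {c | c ∈ C d ∧ β < c}) (hCcof β (hCsub hβ))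
  have hnext_le : ∀ β γ, γ ∈ C d → β < γ → next β ≤ γ := fun β γ hγ h => csInf_le' ⟨hγ, h⟩
  let B : Ordinal.{u} → Set α := fun β => {a | proj S (g (x (β + 1))) a < g (x (next β)) a ∧
    ∀ k ∈ C d, k ≤ β → g (x k) a ≤ g (x (β + 1)) a}
  have hB : ∀ β ∈ C d, ∃ᶠ a in dualFilter I, a ∈ B β := by
    intro β hβ
    obtain ⟨hn, hβn⟩ := hnext β hβ
    have hlt : x (β + 1) < lam.ord := hxlt _ (add_one_lt_ord hμreg (hCμ β hβ)).le
    have hβn' : β + 1 < next β :=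
      (Order.succ_le_of_lt (hF β (hCμ β hβ)).2.1).trans_lt (hCF hn β hβn)
    have hle : nxt (x (β + 1)) ≤ x (next β) :=
      ((le_max_right _ _).trans (le_max_left _ _)).trans (hΦle _ _ hβn')
    refine ((hnxt _ hlt).and_eventually
      ((hg.eventually_le hle (hxlt _ (hCμ _ hn).le)).and (hbd β hβ))).mono ?_
    rintro a ⟨h1, h2, h3⟩
    exact ⟨h1.trans_le h2, h3⟩
  -- At a point `a` common to `θ` many of the sets `B β`, the projections strictly increase.
  obtain ⟨H, hHsub, hHcard, a, ha⟩ := hI.exists_subset hCcard hB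
  have hxC : ∀ β ∈ H, x (β + 1) < lam.ord := fun β hβ =>
    hxlt _ (add_one_lt_ord hμreg (hCμ β (hHsub hβ))).le
  have hproj : ∀ β ∈ H, proj S (g (x (β + 1))) a ∈ S a ∧
      g (x (β + 1)) a ≤ proj S (g (x (β + 1))) a := fun β hβ =>
    proj_mem (hS _ (hxC β hβ) a)
  have hstrict : ∀ β ∈ H, ∀ γ ∈ H, β < γ →
      proj S (g (x (β + 1))) a < proj S (g (x (γ + 1))) a := by
    intro β hβ γ hγ h
    exact (ha β hβ).1.trans_le (((ha γ hγ).2 _ (hnext β (hHsub hβ)).1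
      (hnext_le β γ (hHsub hγ) h)).trans (hproj γ hγ).2)
  have hinj : Function.Injective
      (fun β : H => (⟨proj S (g (x (β.1 + 1))) a, (hproj β.1 β.2).1⟩ : S a)) := by
    have : StrictMono
        (fun β : H => (⟨proj S (g (x (β.1 + 1))) a, (hproj β.1 β.2).1⟩ : S a)) :=
      fun β γ h => hstrict β.1 β.2 γ.1 γ.2 h
    exact this.injective
  have := mk_le_of_injective hinj
  rw [hHcard] at this
  exact absurd (hcard a) this.not_gt

/-! ### Exact upper bounds -/

theorem mk_insert_lt {κ : Cardinal.{u}} (hκ : ℵ₀ ≤ κ) {s : Set Ordinal.{u}} {x : Ordinal.{u}}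
    (hs : #s < lift.{u + 1} κ) : #(insert x s : Set Ordinal.{u}) < lift.{u + 1} κ := by
  have hκ' : ℵ₀ ≤ lift.{u + 1} κ := aleph0_le_lift.2 hκ
  exact mk_insert_le.trans_lt (add_lt_of_lt hκ' hs (one_lt_aleph0.trans_le hκ'))

/-- If there were no least upper bound, then one could go on adding to the sets `S a` the values of
a strictly smaller upper bound. The projections of one fixed `g η` to these `θ` many stages decrease,
each on a positive set, so that by `θ`-regularity infinitely many of them decrease at a common
point. -/
theorem Obedient.exists_isLeastUpperBoundMod {α : Type v} {I : Order.Ideal (Set α)}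
    {θ lam : Cardinal.{u}} (hθ : θ.IsRegular) (hlam : lam.IsRegular)
    (hθlam : Order.succ (Order.succ θ) < lam) (hI : IsRegularIdeal I θ)
    {g : Ordinal.{u} → α → Ordinal.{u}} (hg : IncreasingMod I lam g)
    (hob : Obedient I lam (Order.succ (Order.succ θ)) g) {τ : α → Ordinal.{u}}
    (hτ : ∀ ξ < lam.ord, ∀ a, g ξ a ≤ τ a) :
    ∃ h, IsLeastUpperBoundMod I (g '' Iio lam.ord) h := by
  by_contra! hcon
  have hU : ∀ S : α → Set Ordinal.{u}, ∃ u : α → Ordinal.{u}, ∃ ξ < lam.ord,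
      (∀ a, τ a ∈ S a) → (∀ a, #(S a) < lift.{u + 1} θ) →
        IsUpperBoundMod I (g '' Iio lam.ord) (proj S (g ξ)) ∧
        IsUpperBoundMod I (g '' Iio lam.ord) u ∧
        ∃ᶠ a in dualFilter I, u a < proj S (g ξ) a := by
    intro S
    by_cases hS : (∀ a, τ a ∈ S a) ∧ ∀ a, #(S a) < lift.{u + 1} θ
    · obtain ⟨ξ, hξ, hub⟩ := hob.exists_isUpperBoundMod_proj hθ hlam hθlam hI hg
        (fun ξ hξ a => ⟨τ a, hS.1 a, hτ ξ hξ a⟩) hS.2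
      have h1 := hcon (proj S (g ξ))
      simp only [IsLeastUpperBoundMod, not_and, not_forall] at h1
      obtain ⟨u, hu, h2⟩ := h1 hub
      refine ⟨u, ξ, hξ, fun _ _ => ⟨hub, hu, fun h3 => h2 (relMod_iff.2 ?_)⟩⟩
      exact h3.mono fun a ha => not_lt.1 ha
    · exact ⟨fun _ => 0, 0, hlam.ord_pos, fun h1 h2 => absurd ⟨h1, h2⟩ hS⟩
  choose U Ξ hΞ hU using hU
  obtain ⟨u, hu⟩ := exists_rec (X := α → Ordinal.{u})
    (fun i prev => U fun a => insert (τ a) ((fun j => prev j a) '' Iio i))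
  let S : Ordinal.{u} → α → Set Ordinal.{u} := fun i a =>
    insert (τ a) ((fun j => u j a) '' Iio i)
  have hu : ∀ i, u i = U (S i) := by
    intro i
    rw [hu]
    refine congrArg U (funext fun a => congrArg (insert (τ a)) (image_congr fun j hj => ?_))
    simp only [if_pos (mem_Iio.1 hj)]
  have hSτ : ∀ i a, τ a ∈ S i a := fun i a => mem_insert _ _
  have hScard : ∀ i < θ.ord, ∀ a, #(S i a) < lift.{u + 1} θ := fun i hi a =>
    mk_insert_lt hθ.aleph0_le (mk_image_le.trans_lt (mk_Iio_lt hi))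
  have hθlam' : θ < lam := (Order.lt_succ θ).trans ((Order.lt_succ _).trans hθlam)
  set η := supBelow (fun i => Ξ (S i)) θ.ord
  have hηlam : η < lam.ord := supBelow_lt_ord hlam (ord_lt_ord.2 hθlam') fun i _ => hΞ _
  let B : Ordinal.{u} → Set α := fun i => {a | u i a < proj (S i) (g η) a ∧ g η a ≤ u i a}
  have hB : ∀ i ∈ Iio θ.ord, ∃ᶠ a in dualFilter I, a ∈ B i := by
    intro i hi
    obtain ⟨-, h2, h3⟩ := hU (S i) (hSτ i) (hScard i hi)
    rw [← hu i] at h2 h3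
    refine (h3.and_eventually ((relMod_iff.1 (h2 _ (mem_image_of_mem g hηlam))).and
      (hg.eventually_le (le_supBelow (fun i => Ξ (S i)) hi) hηlam))).mono ?_
    rintro a ⟨h4, h5, h6⟩
    obtain ⟨h7, h8⟩ := proj_mem (S := S i) ⟨τ a, hSτ i a, hτ η hηlam a⟩
    exact ⟨h4.trans_le (proj_le h7 (h6.trans h8)), h5⟩
  have hcard : #(Iio θ.ord) = lift.{u + 1} θ := by rw [mk_Iio_ordinal, card_ord]
  obtain ⟨H, hHsub, hHcard, a, ha⟩ := hI.exists_subset hcard hB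
  have hanti : StrictAnti fun i : H => proj (S i) (g η) a := fun i j hij =>
    (proj_le (S := S j) (mem_insert_of_mem _ (mem_image_of_mem (fun j => u j a) (mem_Iio.2 hij)))
      (ha i i.2).2).trans_lt (ha i i.2).1
  have : Infinite H := by
    rw [Cardinal.infinite_iff, hHcard]
    exact aleph0_le_lift.2 hθ.aleph0_le
  have : WellFoundedGT H := hanti.wellFoundedGT
  exact not_finite_iff_infinite.2 ‹Infinite H› (Finite.of_wellFoundedLT_wellFoundedGT H)

/-- A least upper bound of an obedient sequence is exact, and its values have cofinality at least
`θ`: otherwise projecting to two or to fewer than `θ` suitable values gives an upper bound that is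
smaller on a positive set. -/
theorem Obedient.good {α : Type v} {I : Order.Ideal (Set α)}
    {θ lam : Cardinal.{u}} (hθ : θ.IsRegular) (hlam : lam.IsRegular)
    (hθlam : Order.succ (Order.succ θ) < lam) (hI : IsRegularIdeal I θ)
    {g : Ordinal.{u} → α → Ordinal.{u}} (hg : IncreasingMod I lam g)
    (hob : Obedient I lam (Order.succ (Order.succ θ)) g) {τ : α → Ordinal.{u}}
    (hτ : ∀ ξ < lam.ord, ∀ a, g ξ a ≤ τ a) : Good I lam θ g := by
  classical
  obtain ⟨h, hlub⟩ := hob.exists_isLeastUpperBoundMod hθ hlam hθlam hI hg hτ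
  refine ⟨h, ⟨hlub, fun k hk => ?_⟩, ?_⟩
  · by_contra! hcon
    obtain ⟨ξ, hξ, hub⟩ := hob.exists_isUpperBoundMod_proj hθ hlam hθlam hI hg
      (S := fun a => {τ a, k a}) (fun ξ hξ a => ⟨τ a, mem_insert _ _, hτ ξ hξ a⟩)
      (fun a => mk_insert_lt hθ.aleph0_le (by
        rw [mk_singleton]
        exact one_lt_aleph0.trans_le (aleph0_le_lift.2 hθ.aleph0_le)))
    refine hcon (g ξ) (mem_image_of_mem g hξ) (relMod_iff.2 ?_)
    filter_upwards [relMod_iff.1 hk, relMod_iff.1 (hlub.2 _ hub)] with a h1 h2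
    by_contra h3
    exact (h2.trans (proj_le (mem_insert_of_mem _ rfl) (not_lt.1 h3))).not_gt h1
  · choose K hK hKcof hKcard using exists_cofinal_subset.{u}
    obtain ⟨ξ, hξ, hub⟩ := hob.exists_isUpperBoundMod_proj hθ hlam hθlam hI hg
      (S := fun a => insert (τ a) (if (h a).cof < θ then K (h a) else ∅))
      (fun ξ hξ a => ⟨τ a, mem_insert _ _, hτ ξ hξ a⟩)
      (fun a => mk_insert_lt hθ.aleph0_le (by
        split_ifs with h1
        · rwa [hKcard, lift_lt]
        · rw [mk_eq_zero]
          exact aleph0_pos.trans_le (aleph0_le_lift.2 hθ.aleph0_le)))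
    have hξ' := add_one_lt_ord hlam hξ
    have hev : ∀ᶠ a in dualFilter I, θ ≤ (h a).cof := by
      filter_upwards [relMod_iff.1 (hlub.2 _ hub), relMod_iff.1 (hg _ _ (Order.lt_succ ξ) hξ'),
        relMod_iff.1 (hlub.1 _ (mem_image_of_mem g hξ'))] with a h1 h2 h3
      by_contra h4
      obtain ⟨c, hc, hcle⟩ := hKcof (h a) (g ξ a) (h2.trans_le h3)
      have h5 : c ∈ insert (τ a) (if (h a).cof < θ then K (h a) else ∅) := by
        rw [if_pos (not_le.1 h4)]
        exact mem_insert_of_mem _ hc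
      exact (h1.trans (proj_le (S := fun a => insert (τ a) (if (h a).cof < θ then K (h a) else ∅))
        h5 hcle)).not_gt (hK _ hc)
    simpa [eventually_dualFilter] using hev

/-! ### Construction of an obedient sequence -/

theorem mk_limitPts_inter_Iio_le {K : Set Ordinal.{u}} {δ : Ordinal.{u}}
    (hK : ∀ x < δ, ∃ c ∈ K, x ≤ c) : #(limitPts K ∩ Iio δ : Set Ordinal.{u}) ≤ #K := by
  -- A limit point is determined by the first element of `K` that is not below it.
  have hmem : ∀ x : (limitPts K ∩ Iio δ : Set Ordinal.{u}),
      sInf {c | c ∈ K ∧ x ≤ c} ∈ {c | c ∈ K ∧ x ≤ c} := fun x => csInf_mem (hK x x.2.2)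
  refine mk_le_of_injective (f := fun x => ⟨sInf {c | c ∈ K ∧ x ≤ c}, (hmem x).1⟩) ?_
  refine StrictMono.injective fun x y hxy => ?_
  obtain ⟨c, hc, hxc, hcy⟩ := y.2.1 x hxy
  exact (csInf_le' ⟨hc, hxc.le⟩ : sInf {c | c ∈ K ∧ x ≤ c} ≤ c).trans_lt
    (hcy.trans_le (hmem y).2)

/-- Above every sequence in a `lam`-directed product there is an increasing one that is obedient at
all cofinalities that are `I`-almost everywhere smaller than `a`. -/
theorem exists_obedient {A : Set Cardinal.{u}} (hA : ∀ a ∈ A, a.IsRegular)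
    {I : Order.Ideal (Set A)} {lam : Cardinal.{u}} (hdir : ProdDirected A I lam)
    {f : Ordinal.{u} → A → Ordinal.{u}} (hf : ∀ ξ < lam.ord, f ξ ∈ prodSet A) :
    ∃ g : Ordinal.{u} → A → Ordinal.{u}, (∀ ξ < lam.ord, g ξ ∈ prodSet A) ∧
      IncreasingMod I lam g ∧ (∀ ξ a, f ξ a < g (Order.succ ξ) a) ∧
      ∀ μ : Cardinal.{u}, {a : A | (a : Cardinal.{u}) ≤ μ} ∈ I → Obedient I lam μ g := by
  classical
  have hbnd : ∀ F : Set (A → Ordinal.{u}), ∃ h ∈ prodSet A,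
      F ⊆ prodSet A → #F < lift.{u + 1} lam → IsUpperBoundMod I F h := by
    intro F
    by_cases hF : F ⊆ prodSet A ∧ #F < lift.{u + 1} lam
    · obtain ⟨h, hh, hub⟩ := hdir F hF.1 hF.2
      exact ⟨h, hh, fun _ _ => hub⟩
    · exact ⟨fun _ => 0, fun a => (hA a a.2).ord_pos, fun h1 h2 => absurd ⟨h1, h2⟩ hF⟩
  choose bnd hbnd_mem hbnd using hbnd
  choose K hK hKcof hKcard using exists_cofinal_subset.{u}
  -- `sSup (Iio i)` is the predecessor of a successor `i`, and `i` itself otherwise.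
  obtain ⟨g, hg⟩ := exists_rec (X := A → Ordinal.{u}) (fun i prev a =>
    max (max (bnd (prev '' Iio i) a + 1) (f (sSup (Iio i)) a + 1))
      (if i.cof < a then sSup ((fun j => prev j a) '' (limitPts (K i) ∩ Iio i)) else 0))
  have hg : ∀ i a, g i a = max (max (bnd (g '' Iio i) a + 1) (f (sSup (Iio i)) a + 1))
      (if i.cof < a then sSup ((fun j => g j a) '' (limitPts (K i) ∩ Iio i)) else 0) := by
    intro i a
    have h1 : (fun j => if j < i then g j else default) '' Iio i = g '' Iio i :=
      image_congr fun j hj => if_pos hj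
    have h2 : (fun j => (fun j => if j < i then g j else default) j a) '' (limitPts (K i) ∩ Iio i) =
        (fun j => g j a) '' (limitPts (K i) ∩ Iio i) :=
      image_congr fun j hj => by simp only [if_pos (mem_Iio.1 hj.2)]
    rw [hg, h1]
    simp only [h2]
  have hmem : ∀ i, i < lam.ord → g i ∈ prodSet A := by
    intro i
    induction i using WellFoundedLT.induction with
    | ind i ih =>
      intro hi a
      have ha := hA a a.2
      rw [hg]
      refine max_lt (max_lt (add_one_lt_ord ha (hbnd_mem _ a)) (add_one_lt_ord ha (hf _ ?_ a))) ?_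
      · exact (csSup_le' fun j hj => (mem_Iio.1 hj).le : sSup (Iio i) ≤ i).trans_lt hi
      · split_ifs with hcof
        · refine sSup_lt_ord_of_isRegular ha (mk_image_le.trans_lt
            ((mk_limitPts_inter_Iio_le (hKcof i)).trans_lt ?_)) ?_
          · rwa [hKcard, lift_lt]
          · rintro _ ⟨j, hj, rfl⟩
            exact ih j hj.2 ((mem_Iio.1 hj.2).trans hi) a
        · exact ha.ord_pos
  refine ⟨g, hmem, ?_, ?_, ?_⟩
  · intro η ξ hηξ hξ
    have hub := hbnd (g '' Iio ξ) (by
      rintro _ ⟨j, hj, rfl⟩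
      exact hmem j ((mem_Iio.1 hj).trans hξ)) (mk_image_le.trans_lt (mk_Iio_lt hξ))
    refine relMod_iff.2 ((relMod_iff.1 (hub _ (mem_image_of_mem g hηξ))).mono fun a ha => ?_)
    rw [hg ξ a]
    exact (Order.lt_add_one_iff.2 ha).trans_le ((le_max_left _ _).trans (le_max_left _ _))
  · intro ξ a
    rw [hg (Order.succ ξ) a, Order.Iio_succ, csSup_Iic]
    exact (Order.lt_add_one_iff.2 le_rfl).trans_le ((le_max_right _ _).trans (le_max_left _ _))
  · intro μ hμ δ _ hcof
    refine ⟨K δ, hK δ, hKcof δ, ?_⟩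
    have hev : ∀ᶠ a : A in dualFilter I, μ < a := by
      simpa [eventually_dualFilter] using hμ
    refine hev.mono fun a ha ξ hξ hξδ => ?_
    rw [hg δ a, if_pos (hcof ▸ ha)]
    have : Small.{u} (limitPts (K δ) ∩ Iio δ : Set Ordinal.{u}) := small_subset inter_subset_right
    have hmemξ : ξ ∈ limitPts (K δ) ∩ Iio δ := ⟨hξ, hξδ⟩
    exact (le_csSup Ordinal.bddAbove_of_small
      (mem_image_of_mem (fun j => g j a) hmemξ)).trans (le_max_right _ _)

end PCF

theorem mainTheorem2 (A : Set Cardinal.{u}) [Small.{u} A] (hA : ∀ a ∈ A, a.IsRegular)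
    (I : Order.Ideal (Set A)) (lam : Cardinal.{u}) (hlam : lam.IsRegular)
    (hreg : PCF.reg.{u} I < lam) (hdir : PCF.ProdDirected A I lam)
    (f : Ordinal.{u} → A → Ordinal.{u}) (hf : ∀ ξ < lam.ord, f ξ ∈ PCF.prodSet A)
    (hfinc : PCF.IncreasingMod I lam f) :
    ∃ g : Ordinal.{u} → A → Ordinal.{u},
      (∀ ξ < lam.ord, g ξ ∈ PCF.prodSet A) ∧
      PCF.IncreasingMod I lam g ∧
      (∀ ξ < lam.ord, ∀ a : A, f ξ a < g (Order.succ ξ) a) ∧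
      ∀ θ : Cardinal.{u}, θ.IsRegular → Order.succ (Order.succ θ) < lam →
        {a : A | (a : Cardinal.{u}) ≤ Order.succ (Order.succ θ)} ∈ I →
        PCF.IsRegularIdeal I θ → PCF.Good I lam θ g := by
  obtain ⟨g, hg, hinc, hfg, hob⟩ := PCF.exists_obedient hA hdir hf
  refine ⟨g, hg, hinc, fun ξ _ => hfg ξ, fun θ hθ hθlam hθI hI => ?_⟩
  exact (hob _ hθI).good hθ hlam hθlam hI hinc (τ := fun a => (a : Cardinal.{u}).ord)
    fun ξ hξ a => (hg ξ hξ a).le
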